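/- **Hypergraphs.** A (finite) hypergraph $G$ consists of finite sets $V$ of vertices, $E$ of edges and $X$ of hinges, a map $\psi\colon X\to V$ and a surjection $\phi\colon X\to E$; the hinge $x$ attaches the edge $\phi(x)$ to the vertex $\psi(x)$. The degree of a vertex $v$ is $|\psi^{-1}(v)|$. For $U\subseteq V$, an edge $e$ *joins* $U$ if it has exactly one hinge at each vertex of $U$ and no other hinge. Multiple edges are allowed. **Factorizations.** For $R=[r_1,\dots,r_k]^T$ with positive integer entries, $G$ is *$R$-factorizable* if $E$ has a partition $\{F_1,\dots,F_k\}$ such that, for each $1\le i\le k$, the spanning sub-hypergraph of $G$ formed by all the vertices, the edges in $F_i$ and all their hinges is $r_i$-regular (every vertex has degree $r_i$). **The hypergraph $\Lambda K^H_{p_1,\dots,p_n}$.** Let $k,m,n\ge 1$, let $p_1,\dots,p_n$ be positive integers, let $\Lambda=[\lambda_1,\dots,\lambda_m]^T$ have positive integer entries, and let $H=[h_1,\dots,h_m]^T$ with $h_1,\dots,h_m$ distinct integers in $\{2,\dots,n\}$. $\Lambda K^H_{p_1,\dots,p_n}$ denotes a hypergraph whose vertex set is partitioned into $V_1,\dots,V_n$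 with $|V_i|=p_i$, in which, for each $1\le j\le m$, every set of $h_j$ vertices containing at most one vertex of each part is joined by exactly $\lambda_j$ edges, and which has no other edges. **Theorem 6.2.** Let $R=[r_1,\dots,r_k]^T$ have positive integer entries. Then $\Lambda K^H_{p_1,\dots,p_n}$ is $R$-factorizable if and only if there is an integer $p$ such that 1. $p_1=\dots=p_n=p$; 2. $\displaystyle\sum_{i=1}^k r_i=\sum_{j=1}^m\lambda_j\binom{n-1}{h_j-1}p^{h_j-1}$; and 3. there is a $k\times m$ matrix $A=[a_{ij}]$ of nonnegative integers such that $AH=npR$ and $\displaystyle\sum_{i=1}^k a_{ij}=\lambda_j\binom{n}{h_j}p^{h_j}$ for $1\le j\le m$. -/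

import Mathlib

/-- A finite hypergraph with vertices `V`, edges `E` and hinges `X`. The hinge `x` attaches the
edge `edge x` to the vertex `vert x`; every edge has at least one hinge. Multiple edges are
allowed, and so are edges with several hinges at one vertex. -/
structure HingeHypergraph (V E X : Type*) where
  finite_vertices : Finite V
  finite_edges : Finite E
  finite_hinges : Finite X
  vert : X → V
  edge : X → E
  edge_surjective : Function.Surjective edge

namespace HingeHypergraph

/-- The degree of `v`: the number of hinges incident with `v`. -/
noncomputable def degree {V E X : Type*} (G : HingeHypergraph V E X) (v : V) : ℕ :=
  Set.ncard {x : X | G.vert x = v}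

/-- The number `|H(v, e)|` of hinges incident with both `v` and `e`. -/
noncomputable def hingeCount {V E X : Type*} (G : HingeHypergraph V E X) (v : V) (e : E) : ℕ :=
  Set.ncard {x : X | G.vert x = v ∧ G.edge x = e}

open Classical in
/-- The set `E(U)` of edges joining exactly the multiset `U` of vertices. -/
def edgesOn {V E X : Type*} (G : HingeHypergraph V E X) (U : Multiset V) : Set E :=
  {e : E | ∀ v : V, G.hingeCount v e = U.count v}

/-- The multiplicity `m(U) = |E(U)|` of a multiset `U` of vertices. -/
noncomputable def mult {V E X : Type*} (G : HingeHypergraph V E X) (U : Multiset V) : ℕ :=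
  Set.ncard (G.edgesOn U)

/-- The spanning sub-hypergraph with edge set `S`: all vertices, the edges in `S`, and all the
hinges of those edges. -/
def spanningSub {V E X : Type*} (G : HingeHypergraph V E X) (S : Set E) :
    HingeHypergraph V S {x : X // G.edge x ∈ S} where
  finite_vertices := G.finite_vertices
  finite_edges := haveI := G.finite_edges; inferInstance
  finite_hinges := haveI := G.finite_hinges; inferInstance
  vert x := G.vert x.1
  edge x := ⟨G.edge x.1, x.2⟩
  edge_surjective := by
    rintro ⟨e, he⟩
    obtain ⟨x, rfl⟩ := G.edge_surjective e
    exact ⟨⟨x, he⟩, rfl⟩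

/-- `G` is `r`-regular: every vertex has degree `r`. -/
def IsRegular {V E X : Type*} (G : HingeHypergraph V E X) (r : ℕ) : Prop :=
  ∀ v : V, G.degree v = r

/-- `G` is `R`-factorizable: its edge set has a partition `F₁, …, F_k` such that the spanning
sub-hypergraph with edge set `F i` is `R i`-regular for every `i`. -/
def IsFactorizable {V E X : Type*} (G : HingeHypergraph V E X) {k : ℕ} (R : Fin k → ℕ) : Prop :=
  ∃ F : Fin k → Set E,
    (∀ i, (F i).Nonempty) ∧ Pairwise (fun i i' => Disjoint (F i) (F i')) ∧ ⋃ i, F i = Set.univ ∧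
      ∀ i, (G.spanningSub (F i)).IsRegular (R i)

/-- `G` is a hypergraph `Λ K^H_{p₁, …, pₙ}` with `Λ = lam`, `H = h` and with vertex partition
given by `part : V → Fin n`. The `i`-th part has `p i` vertices; each set of `h j` vertices with
at most one vertex in each part is joined by exactly `lam j` edges; and there are no other edges.
An edge in `E(U)`, for a set `U`, has exactly one hinge at each vertex of `U` and no other hinge. -/
structure IsLambdaK {V E X : Type*} (G : HingeHypergraph V E X) {m n : ℕ}
    (lam h : Fin m → ℕ) (p : Fin n → ℕ) (part : V → Fin n) : Prop where
  card_part : ∀ i : Fin n, Set.ncard {v : V | part v = i} = p i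
  mult_eq : ∀ (j : Fin m) (U : Finset V), U.card = h j → Set.InjOn part (U : Set V) →
    G.mult U.val = lam j
  edge_form : ∀ e : E, ∃ (j : Fin m) (U : Finset V), U.card = h j ∧
    Set.InjOn part (U : Set V) ∧ e ∈ G.edgesOn U.val

end HingeHypergraph

/-! Once each edge is identified with its vertex set, a factorization is a colouring of the edges in
which every vertex lies on exactly `R i` edges of colour `i`.

Necessity is double counting. For two parts of sizes x and y, a vertex in the first has degree s + y
* t, where s and t depend only on the other parts; a vertex in the second has degree s + x * t.
These degrees agree, and t > 0 because 2 ≤ `h j` ≤ n, so x = y. The matrix entry `A i j` counts the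
edges of colour `i` and size `h j`.

For sufficiency, amalgamate each part to a point. Colour the edges of each size with the frequencies
given by `A`. In the manner of Baranyai, `exists_balanced_subsets` assigns them sets of parts, using
every set of a given size equally often and covering each part `q * R i` times in colour `i`. Then
`exists_balanced_transversals` detaches each part into its `q` vertices, so that all transversals
are used equally often and each colour has the right degree at each vertex. The result has as many
edges on every vertex set as the given hypergraph, so a bijection carries the colouring over.

Both constructions treat one part at a time and rest on `exists_finset_card_eq_sum`, the integrality
of a bipartite transportation polytope. The edges are partitioned by colour and by the choices made
so far; a uniform fractional choice has integral class sums for both partitions, and it can be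
rounded without changing any of them. -/

/-! ### Integral rounding for two partitions -/

/-- In a finite sum of weights in `[0, 1]` with integral value, a fractional term is never the
only fractional term. -/
theorem exists_ne_fractional_of_sum_eq_int {E : Type*} [DecidableEq E] {C : Finset E} {w : E → ℚ}
    (h0 : ∀ e, 0 ≤ w e) (h1 : ∀ e, w e ≤ 1) {z : ℤ} (hz : ∑ e ∈ C, w e = z) {a : E} (ha : a ∈ C)
    (ha0 : 0 < w a) (ha1 : w a < 1) : ∃ b ∈ C, b ≠ a ∧ 0 < w b ∧ w b < 1 := by
  by_contra! hcon
  have key : ∀ b ∈ C.erase a, w b = ((if w b = 1 then 1 else 0 : ℤ) : ℚ) := by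
    intro b hb
    rw [Finset.mem_erase] at hb
    split_ifs with h
    · simpa using h
    · rcases (h0 b).eq_or_lt with h' | h'
      · simpa using h'.symm
      · exact absurd (le_antisymm (h1 b) (hcon b hb.2 hb.1 h')) h
  rw [← Finset.add_sum_erase _ _ ha, Finset.sum_congr rfl key, ← Int.cast_sum] at hz
  set y : ℤ := ∑ b ∈ C.erase a, if w b = 1 then 1 else 0
  have h2 : w a = ((z - y : ℤ) : ℚ) := by push_cast; linarith
  rw [h2] at ha0 ha1
  have h3 : 0 < z - y := by exact_mod_cast ha0
  have h4 : z - y < 1 := by exact_mod_cast ha1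
  omega

theorem two_mul_card_image_le {E A : Type*} [DecidableEq E] [DecidableEq A] (F : Finset E)
    (f : E → A) (h : ∀ a ∈ F, ∃ b ∈ F, b ≠ a ∧ f b = f a) : 2 * (F.image f).card ≤ F.card := by
  rw [Finset.card_eq_sum_card_image f F, mul_comm, ← smul_eq_mul]
  refine Finset.card_nsmul_le_sum _ _ _ fun x hx => ?_
  obtain ⟨a, ha, rfl⟩ := Finset.mem_image.1 hx
  obtain ⟨b, hb, hne, hf⟩ := h a ha
  exact Finset.one_lt_card.2 ⟨b, by simp [hb, hf], a, by simp [ha], hne⟩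

/-- Two partitions of a nonempty finite set, all of whose classes have at least two elements, admit
a nonzero function whose sum over each class of either partition vanishes. -/
theorem exists_ne_zero_class_sums_eq_zero {E A B : Type*} [Fintype E] [DecidableEq E]
    [DecidableEq A] [DecidableEq B] (α : E → A) (β : E → B) (F : Finset E) (hF : F.Nonempty)
    (hα : ∀ a ∈ F, ∃ b ∈ F, b ≠ a ∧ α b = α a) (hβ : ∀ a ∈ F, ∃ b ∈ F, b ≠ a ∧ β b = β a) :
    ∃ d : E → ℚ, (∀ e, e ∉ F → d e = 0) ∧ (∃ e, d e ≠ 0) ∧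
      (∀ a, ∑ e with α e = a, d e = 0) ∧ ∀ b, ∑ e with β e = b, d e = 0 := by
  let L : (F → ℚ) →ₗ[ℚ] (F.image α → ℚ) × (F.image β → ℚ) :=
    { toFun := fun d => (fun a => ∑ x : F, if α x = a then d x else 0,
        fun b => ∑ x : F, if β x = b then d x else 0)
      map_add' := by
        intro x y
        ext i <;> simp only [Prod.mk_add_mk, Pi.add_apply, ← Finset.sum_add_distrib] <;>
          exact Finset.sum_congr rfl fun _ _ => by split_ifs <;> simp
      map_smul' := by
        intro c y
        ext i <;> simp [Finset.mul_sum] }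
  -- Classes have at least two elements, so the target has dimension at most `#F`, and an injective
  -- `L` would be onto. But both families of class sums add up to the total of `d`, so (1, 0) is not
  -- attained.
  have hL : ¬ Function.Injective L := by
    intro hinj
    have h1 := two_mul_card_image_le F α hα
    have h2 := two_mul_card_image_le F β hβ
    have hle := LinearMap.finrank_le_finrank_of_injective hinj
    have hdim : Module.finrank ℚ (F → ℚ) =
        Module.finrank ℚ ((F.image α → ℚ) × (F.image β → ℚ)) := by
      refine le_antisymm hle ?_
      simp only [Module.finrank_prod, Module.finrank_fintype_fun_eq_card, Fintype.card_coe]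
      omega
    obtain ⟨d, hd⟩ := (LinearMap.injective_iff_surjective_of_finrank_eq_finrank hdim).1 hinj
      (fun _ => 1, fun _ => 0)
    have e1 : ∑ a : F.image α, ∑ x : F, (if α x = a then d x else 0) = ∑ x, d x := by
      rw [Finset.sum_comm]
      refine Finset.sum_congr rfl fun x _ => ?_
      rw [Finset.sum_eq_single ⟨α x, Finset.mem_image_of_mem _ x.2⟩]
      · simp
      · intro b _ hb
        rw [if_neg]
        exact fun h => hb (Subtype.ext h.symm)
      · simp
    have e2 : ∑ a : F.image β, ∑ x : F, (if β x = a then d x else 0) = ∑ x, d x := by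
      rw [Finset.sum_comm]
      refine Finset.sum_congr rfl fun x _ => ?_
      rw [Finset.sum_eq_single ⟨β x, Finset.mem_image_of_mem _ x.2⟩]
      · simp
      · intro b _ hb
        rw [if_neg]
        exact fun h => hb (Subtype.ext h.symm)
      · simp
    have d1 : ∀ a : F.image α, ∑ x : F, (if α x = a then d x else 0) = 1 :=
      fun a => congrFun (congrArg Prod.fst hd) a
    have d2 : ∀ a : F.image β, ∑ x : F, (if β x = a then d x else 0) = 0 :=
      fun a => congrFun (congrArg Prod.snd hd) a
    rw [Finset.sum_congr rfl fun a _ => d1 a] at e1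
    rw [Finset.sum_congr rfl fun a _ => d2 a] at e2
    simp only [Finset.sum_const, Finset.card_univ, Fintype.card_coe, smul_zero] at e1 e2
    rw [← e2] at e1
    simp [Finset.card_eq_zero, hF.ne_empty] at e1
  rw [← LinearMap.ker_eq_bot, ← ne_eq, Submodule.ne_bot_iff] at hL
  obtain ⟨d, hd, hne⟩ := hL
  rw [LinearMap.mem_ker] at hd
  obtain ⟨x0, hx0⟩ := Function.ne_iff.1 hne
  have conv : ∀ (P : E → Prop) [DecidablePred P],
      ∑ e with P e, (if h : e ∈ F then d ⟨e, h⟩ else 0) = ∑ x : F, if P x then d x else 0 := by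
    intro P _
    rw [Finset.sum_filter, ← Finset.sum_subset F.subset_univ (fun x _ hx => by simp [hx]),
      ← Finset.sum_coe_sort F]
    exact Finset.sum_congr rfl fun x _ => by simp
  refine ⟨fun e => if h : e ∈ F then d ⟨e, h⟩ else 0, fun e he => dif_neg he,
    ⟨x0, by simpa using hx0⟩, fun a => ?_, fun b => ?_⟩
  · rw [conv]
    by_cases ha : a ∈ F.image α
    · exact congrFun (congrArg Prod.fst hd) ⟨a, ha⟩
    · refine Finset.sum_eq_zero fun x _ => if_neg ?_
      rintro rfl
      exact ha (Finset.mem_image_of_mem _ x.2)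
  · rw [conv]
    by_cases ha : b ∈ F.image β
    · exact congrFun (congrArg Prod.snd hd) ⟨b, ha⟩
    · refine Finset.sum_eq_zero fun x _ => if_neg ?_
      rintro rfl
      exact ha (Finset.mem_image_of_mem _ x.2)

/-- Weights in `[0, 1]` can be moved in the direction of a nonzero `d` supported on the fractional
weights until one more weight is integral. -/
theorem exists_fewer_fractional {E : Type*} [Fintype E] [DecidableEq E] (w d : E → ℚ)
    (h0 : ∀ e, 0 ≤ w e) (h1 : ∀ e, w e ≤ 1) (hd : ∀ e, ¬ (0 < w e ∧ w e < 1) → d e = 0)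
    (hne : ∃ e, d e ≠ 0) :
    ∃ t : ℚ, (∀ e, 0 ≤ w e + t * d e) ∧ (∀ e, w e + t * d e ≤ 1) ∧
      (Finset.univ.filter fun e => 0 < w e + t * d e ∧ w e + t * d e < 1).card <
        (Finset.univ.filter fun e => 0 < w e ∧ w e < 1).card := by
  obtain ⟨e0, he0⟩ := hne
  -- The largest step that keeps the weight of `e` in [0, 1]. At the minimiser of `b` the weight
  -- reaches 0 or 1 while all the others stay in range.
  let b : E → ℚ := fun e => if 0 < d e then (1 - w e) / d e else w e / (-d e)
  obtain ⟨x, hx, hmin⟩ := Finset.exists_min_image (Finset.univ.filter fun e => d e ≠ 0) b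
    ⟨e0, by simpa using he0⟩
  have hx : d x ≠ 0 := by simpa using hx
  have hb : ∀ e, d e ≠ 0 → 0 ≤ b e := by
    intro e he
    by_cases hpos : 0 < d e
    · simp only [b, if_pos hpos]
      exact div_nonneg (by linarith [h1 e]) hpos.le
    · have : d e < 0 := lt_of_le_of_ne (not_lt.1 hpos) he
      simp only [b, if_neg hpos]
      exact div_nonneg (h0 e) (by linarith)
  have ht := hb x hx
  have hrange : ∀ e, 0 ≤ w e + b x * d e ∧ w e + b x * d e ≤ 1 := by
    intro e
    by_cases he : d e = 0
    · simp [he, h0, h1]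
    · have hle : b x ≤ b e := hmin e (by simpa using he)
      by_cases hpos : 0 < d e
      · have : b e = (1 - w e) / d e := if_pos hpos
        rw [this, le_div_iff₀ hpos] at hle
        exact ⟨add_nonneg (h0 e) (mul_nonneg ht hpos.le), by linarith⟩
      · have hneg : d e < 0 := lt_of_le_of_ne (not_lt.1 hpos) he
        have : b e = w e / (-d e) := if_neg hpos
        rw [this, le_div_iff₀ (by linarith)] at hle
        refine ⟨by linarith, ?_⟩
        have := mul_nonneg ht (neg_nonneg.2 hneg.le)
        linarith [h1 e]
  refine ⟨b x, fun e => (hrange e).1, fun e => (hrange e).2, Finset.card_lt_card ?_⟩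
  rw [Finset.ssubset_iff_of_subset]
  · refine ⟨x, ?_, ?_⟩
    · rw [Finset.mem_filter]
      exact ⟨Finset.mem_univ _, by_contra fun h => hx (hd x h)⟩
    · rw [Finset.mem_filter]
      rintro ⟨-, hx0, hx1⟩
      by_cases hpos : 0 < d x
      · have : b x = (1 - w x) / d x := if_pos hpos
        rw [this, div_mul_cancel₀ _ hx] at hx1
        linarith
      · have : b x = w x / (-d x) := if_neg hpos
        rw [this, div_neg, neg_mul, div_mul_cancel₀ _ hx] at hx0
        linarith
  · intro e he
    rw [Finset.mem_filter] at he ⊢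
    by_contra h
    rw [hd e (fun h' => h ⟨Finset.mem_univ _, h'⟩)] at he
    simp at he h
    linarith [h he.1]

/-- Integral rounding for two partitions: weights in `[0, 1]` whose sums over all classes of two
partitions are integers can be replaced by the indicator of a set with the same class sums. -/
theorem exists_finset_card_eq_sum {E A B : Type*} [Fintype E] [DecidableEq E] [DecidableEq A]
    [DecidableEq B] (α : E → A) (β : E → B) (w : E → ℚ) (h0 : ∀ e, 0 ≤ w e) (h1 : ∀ e, w e ≤ 1)
    (hα : ∀ a, ∃ z : ℤ, ∑ e with α e = a, w e = z) (hβ : ∀ b, ∃ z : ℤ, ∑ e with β e = b, w e = z) :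
    ∃ S : Finset E, (∀ e ∈ S, w e ≠ 0) ∧
      (∀ a, ((S.filter fun e => α e = a).card : ℚ) = ∑ e with α e = a, w e) ∧
      ∀ b, ((S.filter fun e => β e = b).card : ℚ) = ∑ e with β e = b, w e := by
  induction hN : (Finset.univ.filter fun e => 0 < w e ∧ w e < 1).card using
    Nat.strong_induction_on generalizing w with
  | _ N ih =>
  set F := Finset.univ.filter fun e => 0 < w e ∧ w e < 1 with hFdef
  rcases F.eq_empty_or_nonempty with hF | hF
  · have hw : ∀ e, w e = if w e = 1 then 1 else 0 := by
      intro e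
      split_ifs with h
      · exact h
      · by_contra h'
        have : e ∈ F := by
          rw [hFdef, Finset.mem_filter]
          exact ⟨Finset.mem_univ _, lt_of_le_of_ne (h0 e) (Ne.symm h'), lt_of_le_of_ne (h1 e) h⟩
        simp [hF] at this
    have hs : ∀ (P : E → Prop) [DecidablePred P],
        (((Finset.univ.filter fun e => w e = 1).filter P).card : ℚ) = ∑ e with P e, w e := by
      intro P _
      rw [Finset.sum_congr rfl fun e _ => hw e, Finset.sum_boole, Finset.filter_comm]
    refine ⟨Finset.univ.filter fun e => w e = 1, fun e he => ?_, fun a => hs _, fun b => hs _⟩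
    rw [(Finset.mem_filter.1 he).2]
    exact one_ne_zero
  -- An integral class sum forbids a lone fractional weight; this supplies the pairs needed for the
  -- linear algebra.
  · have pair : ∀ (P : E → Prop) [DecidablePred P] (z : ℤ), ∑ e with P e, w e = z →
        ∀ a ∈ F, P a → ∃ b ∈ F, b ≠ a ∧ P b := by
      intro P _ z hz a ha hP
      rw [hFdef, Finset.mem_filter] at ha
      obtain ⟨b, hb, hne, hb'⟩ := exists_ne_fractional_of_sum_eq_int h0 h1 hz (a := a)
        (by simpa using hP) ha.2.1 ha.2.2
      exact ⟨b, by simpa [hFdef] using hb', hne, by simpa using hb⟩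
    obtain ⟨d, hd, hne, hdα, hdβ⟩ := exists_ne_zero_class_sums_eq_zero α β F hF
      (fun a ha => (hα (α a)).elim fun z hz => pair _ z hz a ha rfl)
      (fun a ha => (hβ (β a)).elim fun z hz => pair _ z hz a ha rfl)
    obtain ⟨t, ht0, ht1, hlt⟩ := exists_fewer_fractional w d h0 h1
      (fun e he => hd e (by simpa [hFdef] using he)) hne
    have sα : ∀ a, ∑ e with α e = a, (w e + t * d e) = ∑ e with α e = a, w e := by
      intro a
      rw [Finset.sum_add_distrib, ← Finset.mul_sum, hdα, mul_zero, add_zero]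
    have sβ : ∀ a, ∑ e with β e = a, (w e + t * d e) = ∑ e with β e = a, w e := by
      intro a
      rw [Finset.sum_add_distrib, ← Finset.mul_sum, hdβ, mul_zero, add_zero]
    obtain ⟨S, hS0, hSα, hSβ⟩ := ih _ (hN ▸ hlt) (fun e => w e + t * d e) ht0 ht1
      (fun a => by rw [sα]; exact hα a) (fun b => by rw [sβ]; exact hβ b) rfl
    refine ⟨S, fun e he hw => hS0 e he ?_, fun a => (hSα a).trans (sα a),
      fun b => (hSβ b).trans (sβ b)⟩
    rw [hd e (by simp [hFdef, hw]), hw, mul_zero, add_zero]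

/-! ### Equitable splitting and detachment of parts -/

/-- A finite set carrying two partitions with class sizes divisible by `q` can be split into `q`
pieces, each of which contains the same proportion of every class. -/
theorem exists_equitable_split_nat {E A B : Type*} [Fintype E] [DecidableEq E] [DecidableEq A]
    [DecidableEq B] (α : E → A) (β : E → B) (s : A → ℕ) (t : B → ℕ) (q : ℕ) (D : Finset E)
    (hα : ∀ a, (D.filter fun e => α e = a).card = q * s a)
    (hβ : ∀ b, (D.filter fun e => β e = b).card = q * t b) :
    ∃ f : E → ℕ, (∀ e ∈ D, f e < q) ∧
      (∀ a, ∀ x < q, (D.filter fun e => α e = a ∧ f e = x).card = s a) ∧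
      ∀ b, ∀ x < q, (D.filter fun e => β e = b ∧ f e = x).card = t b := by
  induction q generalizing D with
  | zero =>
    refine ⟨fun _ => 0, fun e he => ?_, by simp, by simp⟩
    have h := hα (α e)
    rw [zero_mul, Finset.card_eq_zero, Finset.filter_eq_empty_iff] at h
    exact absurd rfl (h he)
  | succ q ih =>
    have hq : ((q + 1 : ℕ) : ℚ) ≠ 0 := by positivity
    -- Rounding this constant weight gives a piece with exactly one (q + 1)-th of every class; the
    -- remaining class sizes are divisible by q.
    let w : E → ℚ := fun e => if e ∈ D then 1 / ((q + 1 : ℕ) : ℚ) else 0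
    have hw : ∀ (P : E → Prop) [DecidablePred P] (z : ℕ),
        (D.filter P).card = (q + 1) * z → ∑ e with P e, w e = z := by
      intro P _ z hz
      simp only [w]
      rw [← Finset.sum_filter, Finset.sum_const, nsmul_eq_mul, Finset.filter_filter]
      have : (Finset.univ.filter fun e => P e ∧ e ∈ D) = D.filter P := by
        ext e
        simp [and_comm]
      rw [this, hz]
      push_cast
      push_cast at hq
      field_simp
    obtain ⟨S, hS, hSα, hSβ⟩ := exists_finset_card_eq_sum α β w
      (fun e => by simp only [w]; split_ifs <;> positivity)
      (fun e => by
        simp only [w]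
        split_ifs
        · rw [div_le_one (by positivity)]
          push_cast
          linarith [(Nat.cast_nonneg q : (0 : ℚ) ≤ q)]
        · exact zero_le_one)
      (fun a => ⟨s a, by simpa using hw _ _ (hα a)⟩) (fun b => ⟨t b, by simpa using hw _ _ (hβ b)⟩)
    have hSD : S ⊆ D := fun e he => by
      by_contra h
      exact hS e he (if_neg h)
    have cα : ∀ a, (S.filter fun e => α e = a).card = s a := fun a => by
      exact_mod_cast (hSα a).trans (hw _ _ (hα a))
    have cβ : ∀ b, (S.filter fun e => β e = b).card = t b := fun b => by
      exact_mod_cast (hSβ b).trans (hw _ _ (hβ b))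
    have rest : ∀ (P : E → Prop) [DecidablePred P] (z : ℕ), (D.filter P).card = (q + 1) * z →
        (S.filter P).card = z → ((D \ S).filter P).card = q * z := by
      intro P _ z h1 h2
      have : (D \ S).filter P = D.filter P \ S.filter P := by
        ext e
        simp only [Finset.mem_filter, Finset.mem_sdiff]
        tauto
      rw [this, Finset.card_sdiff_of_subset (Finset.filter_subset_filter _ hSD), h1, h2, add_mul,
        one_mul, Nat.add_sub_cancel]
    obtain ⟨f, hf, fα, fβ⟩ := ih (D \ S) (fun a => rest _ _ (hα a) (cα a))
      (fun b => rest _ _ (hβ b) (cβ b))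
    have count : ∀ (P : E → Prop) [DecidablePred P] (z : ℕ), (S.filter P).card = z →
        (∀ x < q, ((D \ S).filter fun e => P e ∧ f e = x).card = z) →
        ∀ x < q + 1, (D.filter fun e => P e ∧ (if e ∈ S then q else f e) = x).card = z := by
      intro P _ z h1 h2 x hx
      rcases Nat.lt_succ_iff_lt_or_eq.1 hx with hx | rfl
      · rw [← h2 x hx]
        congr 1
        ext e
        simp only [Finset.mem_filter, Finset.mem_sdiff]
        by_cases he : e ∈ S
        · simp [he, hx.ne']
        · simp [he]
      · rw [← h1]
        congr 1
        ext e
        simp only [Finset.mem_filter]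
        by_cases he : e ∈ S
        · simp [he, hSD he]
        · simp only [he, if_false, false_and, iff_false, not_and]
          exact fun hD _ => (hf e (Finset.mem_sdiff.2 ⟨hD, he⟩)).ne
    refine ⟨fun e => if e ∈ S then q else f e, fun e he => ?_,
      fun a => count _ _ (cα a) (fα a), fun b => count _ _ (cβ b) (fβ b)⟩
    by_cases h : e ∈ S
    · simp [h]
    · simp only [h, if_false]
      exact (hf e (Finset.mem_sdiff.2 ⟨he, h⟩)).trans (Nat.lt_succ_self q)

/-- Labels outside `D` are irrelevant to the counts, so the default label 0 makes the splitting
function total with values in `Fin q`. -/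
theorem exists_equitable_split {E A B : Type*} [Fintype E] [DecidableEq E] [DecidableEq A]
    [DecidableEq B] (α : E → A) (β : E → B) {q : ℕ} (hq : 0 < q) (D : Finset E)
    (hα : ∀ a, q ∣ (D.filter fun e => α e = a).card)
    (hβ : ∀ b, q ∣ (D.filter fun e => β e = b).card) :
    ∃ f : E → Fin q,
      (∀ a x, q * (D.filter fun e => α e = a ∧ f e = x).card =
        (D.filter fun e => α e = a).card) ∧
      ∀ b x, q * (D.filter fun e => β e = b ∧ f e = x).card =
        (D.filter fun e => β e = b).card := by
  choose s hs using hα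
  choose t ht using hβ
  obtain ⟨f, hf, fα, fβ⟩ := exists_equitable_split_nat α β s t q D hs ht
  have key : ∀ (P : E → Prop) [DecidablePred P] (x : Fin q),
      (D.filter fun e => P e ∧ (if h : f e < q then (⟨f e, h⟩ : Fin q) else ⟨0, hq⟩) = x) =
        D.filter fun e => P e ∧ f e = x := by
    intro P _ x
    refine Finset.filter_congr fun e he => ?_
    rw [dif_pos (hf e he), Fin.ext_iff]
  refine ⟨fun e => if h : f e < q then ⟨f e, h⟩ else ⟨0, hq⟩, fun a x => ?_, fun b x => ?_⟩
  · rw [key, fα a x x.2, hs]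
  · rw [key, fβ b x x.2, ht]

/-- If every set `T` of parts is the trace of `L T * q ^ #T` elements, and every colour meets every
part `q * r i` times, then each part can be split into `q` points so that all transversals are
used equally often and every colour meets every point `r i` times. -/
theorem exists_balanced_transversals {E ι C : Type*} [Fintype E] [DecidableEq E] [Fintype ι]
    [DecidableEq ι] [DecidableEq C] {q : ℕ} (hq : 0 < q) (τ : E → Finset ι) (c : E → C)
    (r : C → ℕ) (L : Finset ι → ℕ)
    (hc : ∀ i w, (Finset.univ.filter fun e => c e = i ∧ w ∈ τ e).card = q * r i)
    (hτ : ∀ T, (Finset.univ.filter fun e => τ e = T).card = L T * q ^ T.card) :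
    ∃ f : E → ι → Fin q,
      (∀ i w x, (Finset.univ.filter fun e => c e = i ∧ w ∈ τ e ∧ f e w = x).card = r i) ∧
      ∀ T (g : ι → Fin q),
        (Finset.univ.filter fun e => τ e = T ∧ ∀ u ∈ T, f e u = g u).card = L T := by
  -- `P` is the set of parts already split; every part of `T` outside `P` still contributes a factor
  -- `q` of undecided choices.
  suffices H : ∀ P : Finset ι, ∃ f : E → ι → Fin q,
      (∀ i, ∀ w ∈ P, ∀ x,
        (Finset.univ.filter fun e => c e = i ∧ w ∈ τ e ∧ f e w = x).card = r i) ∧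
      ∀ T (g : ι → Fin q),
        (Finset.univ.filter fun e => τ e = T ∧ ∀ u ∈ T, u ∈ P → f e u = g u).card =
          L T * q ^ (T \ P).card by
    obtain ⟨f, h1, h2⟩ := H Finset.univ
    exact ⟨f, fun i w => h1 i w (Finset.mem_univ w), fun T g => by
      simpa [Finset.sdiff_eq_empty_iff_subset.2 (Finset.subset_univ T)] using h2 T g⟩
  intro P
  induction P using Finset.induction_on with
  | empty => exact ⟨fun _ _ => ⟨0, hq⟩, by simp, fun T g => by simpa using hτ T⟩
  | insert w P hw ih =>
    obtain ⟨f, h1, h2⟩ := ih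
    -- Only the choices on `T ∩ P` have been made. Resetting the others to 0 makes them comparable
    -- by equality, so that trace and `nf` together label a partition.
    let nf : Finset ι → (ι → Fin q) → ι → Fin q :=
      fun T g u => if u ∈ T ∧ u ∈ P then g u else ⟨0, hq⟩
    have nf_eq : ∀ T g g', nf T g = nf T g' ↔ ∀ u ∈ T, u ∈ P → g u = g' u := by
      intro T g g'
      rw [funext_iff]
      refine forall_congr' fun u => ?_
      by_cases hu : u ∈ T <;> by_cases hu' : u ∈ P <;> simp [nf, hu, hu']
    let D := Finset.univ.filter fun e => w ∈ τ e
    have hD : ∀ T, w ∈ T → ∀ g, (D.filter fun e => (τ e, nf (τ e) (f e)) = (T, nf T g)) =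
        Finset.univ.filter fun e => τ e = T ∧ ∀ u ∈ T, u ∈ P → f e u = g u := by
      intro T hT g
      ext e
      simp only [D, Finset.mem_filter, Finset.mem_univ, true_and, Prod.mk.injEq]
      constructor
      · rintro ⟨-, rfl, h⟩
        exact ⟨rfl, (nf_eq _ _ _).1 h⟩
      · rintro ⟨rfl, h⟩
        exact ⟨hT, rfl, (nf_eq _ _ _).2 h⟩
    have hcard : ∀ T, w ∈ T → (T \ P).card = (T \ insert w P).card + 1 := by
      intro T hT
      have : T \ P = insert w (T \ insert w P) := by
        ext u
        simp only [Finset.mem_sdiff, Finset.mem_insert, not_or]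
        constructor
        · intro h
          by_cases huw : u = w
          · exact Or.inl huw
          · exact Or.inr ⟨h.1, huw, h.2⟩
        · rintro (rfl | h)
          · exact ⟨hT, hw⟩
          · exact ⟨h.1, h.2.2⟩
      rw [this, Finset.card_insert_of_notMem (by simp)]
    obtain ⟨k, kα, kβ⟩ := exists_equitable_split c (fun e => (τ e, nf (τ e) (f e))) hq D
      (fun i => ⟨r i, by rw [← hc i w, Finset.filter_filter]; simp only [and_comm]⟩)
      (by
        intro b
        rcases (D.filter fun e => (τ e, nf (τ e) (f e)) = b).eq_empty_or_nonempty with h | ⟨e, he⟩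
        · simp [h]
        · rw [Finset.mem_filter] at he
          have hwe : w ∈ τ e := by simpa [D] using he.1
          rw [← he.2, hD _ hwe, h2, hcard _ hwe, pow_succ, ← mul_assoc]
          exact dvd_mul_left _ _)
    refine ⟨fun e => Function.update (f e) w (k e), fun i u hu x => ?_, fun T g => ?_⟩
    · rcases Finset.mem_insert.1 hu with rfl | hu
      · have := kα i x
        have h3 : (D.filter fun e => c e = i).card = q * r i := by
          rw [← hc i u, Finset.filter_filter]; simp only [and_comm]
        rw [h3] at this
        rw [← Nat.eq_of_mul_eq_mul_left hq this]
        congr 1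
        ext e
        simp only [D, Finset.mem_filter, Finset.mem_univ, true_and, Function.update_self]
        tauto
      · have hne : u ≠ w := fun h => hw (h ▸ hu)
        simpa [Function.update_of_ne hne] using h1 i u hu x
    · by_cases hT : w ∈ T
      · have := kβ (T, nf T g) (g w)
        rw [hD T hT, h2, hcard T hT, pow_succ, mul_comm (q ^ _), mul_left_comm] at this
        rw [← Nat.eq_of_mul_eq_mul_left hq this]
        congr 1
        ext e
        have h5 : e ∈ (D.filter fun e => (τ e, nf (τ e) (f e)) = (T, nf T g) ∧ k e = g w) ↔
            (τ e = T ∧ ∀ u ∈ T, u ∈ P → f e u = g u) ∧ k e = g w := by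
          rw [← Finset.filter_filter, hD T hT]
          simp
        rw [h5]
        simp only [Finset.mem_filter, Finset.mem_univ, true_and, Finset.mem_insert]
        constructor
        · rintro ⟨h3, h4⟩
          refine ⟨⟨h3, fun u hu hP => ?_⟩, by simpa using h4 w hT (Or.inl rfl)⟩
          have := h4 u hu (Or.inr hP)
          rwa [Function.update_of_ne (fun h : u = w => hw (h ▸ hP))] at this
        · rintro ⟨⟨h3, h4⟩, h5⟩
          refine ⟨h3, fun u hu hP => ?_⟩
          by_cases huw : u = w
          · subst huw; simpa using h5
          · rw [Function.update_of_ne huw]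
            exact h4 u hu (hP.resolve_left huw)
      · have h3 : T \ insert w P = T \ P := by
          ext u
          simp only [Finset.mem_sdiff, Finset.mem_insert, not_or]
          exact ⟨fun h => ⟨h.1, h.2.2⟩, fun h => ⟨h.1, fun h' => hT (h' ▸ h.1), h.2⟩⟩
        rw [h3, ← h2 T g]
        congr 1
        ext e
        simp only [Finset.mem_filter, Finset.mem_univ, true_and, Finset.mem_insert]
        refine and_congr_right fun _ => forall₂_congr fun u hu => ?_
        have huw : u ≠ w := fun h => hT (h ▸ hu)
        simp [huw]

/-! ### Balanced distribution over subsets -/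

/-- Baranyai-type theorem: if there are `N j * (#ι).choose (h j)` elements of each size class `j`,
and the sizes in each colour class add up to `#ι * d i`, then the elements can be mapped to subsets
of `ι` of the prescribed sizes so that each subset is used equally often and the colour `i` covers
each vertex `d i` times. -/
theorem exists_balanced_subsets {E ι M C : Type*} [Fintype E] [DecidableEq E] [Fintype ι]
    [DecidableEq ι] [DecidableEq M] [DecidableEq C] (sz : E → M) (c : E → C) (h N : M → ℕ)
    (d : C → ℕ)
    (hsz : ∀ j, (Finset.univ.filter fun e => sz e = j).card = N j * (Fintype.card ι).choose (h j))
    (hc : ∀ i, ∑ e with c e = i, h (sz e) = Fintype.card ι * d i) :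
    ∃ τ : E → Finset ι, (∀ e, (τ e).card = h (sz e)) ∧
      (∀ j T, T.card = h j → (Finset.univ.filter fun e => sz e = j ∧ τ e = T).card = N j) ∧
      ∀ i w, (Finset.univ.filter fun e => c e = i ∧ w ∈ τ e).card = d i := by
  -- `P` is the set of points already treated and `τ e` the trace on `P` of the future set. The
  -- binomial coefficient counts the ways to complete a trace `T` outside `P`.
  suffices H : ∀ P : Finset ι, ∃ τ : E → Finset ι, (∀ e, τ e ⊆ P) ∧
      (∀ e, (τ e).card ≤ h (sz e)) ∧
      (∀ j T, T ⊆ P → T.card ≤ h j → (Finset.univ.filter fun e => sz e = j ∧ τ e = T).card =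
        N j * (Fintype.card ι - P.card).choose (h j - T.card)) ∧
      ∀ i, ∀ w ∈ P, (Finset.univ.filter fun e => c e = i ∧ w ∈ τ e).card = d i by
    obtain ⟨τ, -, h2, h3, h4⟩ := H Finset.univ
    refine ⟨τ, fun e => le_antisymm (h2 e) ?_, fun j T hT => ?_,
      fun i w => h4 i w (Finset.mem_univ w)⟩
    -- No points remain, and the class of `e` is nonempty, so `choose 0` of the deficit is positive:
    -- the deficit is 0.
    · have h5 := h3 (sz e) (τ e) (Finset.subset_univ _) (h2 e)
      have h6 : 0 < (Finset.univ.filter fun e' => sz e' = sz e ∧ τ e' = τ e).card :=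
        Finset.card_pos.2 ⟨e, by simp⟩
      rw [h5, Finset.card_univ, Nat.sub_self] at h6
      have h7 := Nat.pos_of_mul_pos_left h6
      by_contra hlt
      rw [Nat.choose_eq_zero_of_lt (by omega)] at h7
      exact absurd h7 (lt_irrefl 0)
    · simpa [hT] using h3 j T (Finset.subset_univ _) hT.le
  intro P
  induction P using Finset.induction_on with
  | empty =>
    refine ⟨fun _ => ∅, by simp, by simp, fun j T hT _ => ?_, by simp⟩
    obtain rfl := Finset.subset_empty.1 hT
    simpa using hsz j
  | insert w P hw ih =>
    obtain ⟨τ, h1, h2, h3, h4⟩ := ih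
    have hPlt : P.card < Fintype.card ι := by
      have := Finset.card_le_univ (insert w P)
      rw [Finset.card_insert_of_notMem hw] at this
      omega
    obtain ⟨a, ha⟩ : ∃ a, Fintype.card ι - P.card = a + 1 := ⟨Fintype.card ι - P.card - 1, by omega⟩
    have hn : Fintype.card ι = P.card + (a + 1) := by omega
    rw [ha] at h3
    -- The proportion of completions of `τ e` that contain `w`: missing points over remaining
    -- points.
    let wt : E → ℚ := fun e => ((h (sz e) : ℚ) - (τ e).card) / (a + 1)
    have ha0 : (0 : ℚ) < a + 1 := by positivity
    have wt0 : ∀ e, 0 ≤ wt e := fun e =>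
      div_nonneg (sub_nonneg.2 (by exact_mod_cast h2 e)) ha0.le
    have wt1 : ∀ e, wt e ≤ 1 := by
      intro e
      -- The class of `e` contains `e`, so its binomial coefficient is nonzero and at most `a + 1`
      -- points are missing.
      have h6 : 0 < (Finset.univ.filter fun e' => sz e' = sz e ∧ τ e' = τ e).card :=
        Finset.card_pos.2 ⟨e, by simp⟩
      rw [h3 _ _ (h1 e) (h2 e)] at h6
      have h7 : h (sz e) - (τ e).card ≤ a + 1 := by
        by_contra hlt
        rw [Nat.choose_eq_zero_of_lt (by omega)] at h6
        simp at h6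
      have h8 : h (sz e) ≤ a + 1 + (τ e).card := by omega
      have h9 : (h (sz e) : ℚ) ≤ a + 1 + (τ e).card := by exact_mod_cast h8
      simp only [wt]
      rw [div_le_one ha0]
      linarith
    have sumα : ∀ i, ∑ e with c e = i, wt e = d i := by
      intro i
      have e1 : ∑ e with c e = i, (τ e).card = P.card * d i := by
        have e2 : ∀ e, (τ e).card = ∑ u ∈ P, if u ∈ τ e then 1 else 0 := by
          intro e
          rw [Finset.sum_boole, Finset.filter_mem_eq_inter, Finset.inter_eq_right.2 (h1 e),
            Nat.cast_id]
        rw [Finset.sum_congr rfl fun e _ => e2 e, Finset.sum_comm, ← smul_eq_mul,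
          ← Finset.sum_const]
        refine Finset.sum_congr rfl fun u hu => ?_
        rw [Finset.sum_boole, Finset.filter_filter, h4 i u hu, Nat.cast_id]
      have e3 : (∑ e with c e = i, (h (sz e) : ℚ)) = (P.card + (a + 1)) * d i := by
        have := hc i
        rw [hn] at this
        exact_mod_cast this
      have e4 : (∑ e with c e = i, ((τ e).card : ℚ)) = P.card * d i := by exact_mod_cast e1
      simp only [wt]
      rw [← Finset.sum_div, Finset.sum_sub_distrib, e3, e4]
      field_simp
      ring
    have sumβ : ∀ j T, T ⊆ P → T.card ≤ h j →
        ∑ e with (sz e, τ e) = (j, T), wt e =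
          ((if h j - T.card = 0 then 0 else N j * a.choose (h j - T.card - 1) : ℕ) : ℚ) := by
      intro j T hT hTj
      have e1 : ∀ e ∈ Finset.univ.filter (fun e => (sz e, τ e) = (j, T)),
          wt e = ((h j - T.card : ℕ) : ℚ) / (a + 1) := by
        intro e he
        have : sz e = j ∧ τ e = T := by simpa using he
        simp only [wt]
        rw [this.1, this.2, Nat.cast_sub hTj]
      rw [Finset.sum_congr rfl e1, Finset.sum_const, nsmul_eq_mul]
      simp only [Prod.mk.injEq]
      rw [h3 j T hT hTj]
      -- Absorption, (a + 1) * C(a, b) = C(a + 1, b + 1) * (b + 1), is what makes the class sum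
      -- integral. Completed traces have weight 0.
      rcases h j - T.card with - | b
      · simp
      · have := Nat.add_one_mul_choose_eq a b
        have h' : ((a : ℚ) + 1) * a.choose b = (a + 1).choose (b + 1) * (b + 1) := by
          exact_mod_cast this
        simp only [Nat.add_one_ne_zero, if_false, Nat.add_sub_cancel]
        push_cast
        rw [← mul_div_assoc, mul_assoc, ← h']
        field_simp
    obtain ⟨S, hS, Sα, Sβ⟩ := exists_finset_card_eq_sum c (fun e => (sz e, τ e)) wt wt0 wt1
      (fun i => ⟨d i, by simpa using sumα i⟩)
      (by
        rintro ⟨j, T⟩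
        by_cases hT : T ⊆ P ∧ T.card ≤ h j
        · exact ⟨_, by rw [sumβ j T hT.1 hT.2]; exact (Int.cast_natCast _).symm⟩
        · refine ⟨0, ?_⟩
          rw [Finset.filter_false_of_mem]
          · simp
          · intro e _ he
            rw [Prod.mk.injEq] at he
            exact hT ⟨he.2 ▸ h1 e, he.2 ▸ he.1 ▸ h2 e⟩)
    have cα : ∀ i, (S.filter fun e => c e = i).card = d i := fun i => by
      exact_mod_cast (Sα i).trans (sumα i)
    have cβ : ∀ j T, T ⊆ P → T.card ≤ h j → (S.filter fun e => sz e = j ∧ τ e = T).card =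
        if h j - T.card = 0 then 0 else N j * a.choose (h j - T.card - 1) := by
      intro j T hT hTj
      have := (Sβ (j, T)).trans (sumβ j T hT hTj)
      simp only [Prod.mk.injEq] at this
      exact_mod_cast this
    have hwτ : ∀ e, w ∉ τ e := fun e he => hw (h1 e he)
    have ha' : Fintype.card ι - (insert w P).card = a := by
      rw [Finset.card_insert_of_notMem hw]
      omega
    refine ⟨fun e => if e ∈ S then insert w (τ e) else τ e, fun e => ?_, fun e => ?_,
      fun j T hT hTj => ?_, fun i u hu => ?_⟩
    · simp only
      split_ifs
      · exact Finset.insert_subset_insert w (h1 e)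
      · exact (h1 e).trans (Finset.subset_insert w P)
    · simp only
      split_ifs with he
      · rw [Finset.card_insert_of_notMem (hwτ e)]
        -- A completed set has weight 0, hence is never selected and cannot overflow.
        refine lt_of_le_of_ne (h2 e) fun heq => hS e he ?_
        simp [wt, heq]
      · exact h2 e
    · rw [ha']
      by_cases hwT : w ∈ T
      · have hT' : T.erase w ⊆ P := by
          rw [← Finset.erase_insert hw]
          exact Finset.erase_subset_erase w hT
        have hcard := Finset.card_erase_add_one hwT
        have := cβ j (T.erase w) hT' (by omega)
        rw [if_neg (by omega), show h j - (T.erase w).card - 1 = h j - T.card by omega] at this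
        rw [← this]
        congr 1
        ext e
        simp only [Finset.mem_filter, Finset.mem_univ, true_and]
        by_cases he : e ∈ S
        · simp only [he, if_true, true_and]
          refine and_congr_right fun _ => ⟨?_, ?_⟩
          · rintro rfl
            rw [Finset.erase_insert (hwτ e)]
          · intro h'
            rw [h', Finset.insert_erase hwT]
        · simp only [he, if_false, false_and, iff_false, not_and]
          exact fun _ h' => hwτ e (h' ▸ hwT)
      · have hT' : T ⊆ P := (Finset.subset_insert_iff_of_notMem hwT).1 hT
        have e1 := h3 j T hT' hTj
        have e2 := cβ j T hT' hTj
        have e3 : (Finset.univ.filter fun e =>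
            sz e = j ∧ (if e ∈ S then insert w (τ e) else τ e) = T) =
            (Finset.univ.filter fun e => sz e = j ∧ τ e = T) \
              S.filter fun e => sz e = j ∧ τ e = T := by
          ext e
          simp only [Finset.mem_filter, Finset.mem_univ, true_and, Finset.mem_sdiff]
          by_cases he : e ∈ S
          · simp only [he, if_true, true_and]
            refine ⟨fun h' => absurd (h'.2 ▸ Finset.mem_insert_self w _) hwT, fun h' => ?_⟩
            exact absurd h'.1 h'.2
          · simp [he]
        rw [e3, Finset.card_sdiff_of_subset
          (Finset.filter_subset_filter _ (Finset.subset_univ S)), e1, e2]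
        rcases h j - T.card with - | b
        · simp
        · simp only [Nat.add_one_ne_zero, if_false, Nat.add_sub_cancel]
          rw [Nat.choose_succ_succ, mul_add, Nat.add_sub_cancel_left]
    · rcases Finset.mem_insert.1 hu with rfl | hu
      · rw [← cα i]
        congr 1
        ext e
        simp only [Finset.mem_filter, Finset.mem_univ, true_and]
        by_cases he : e ∈ S <;> simp [he, hwτ e]
      · rw [← h4 i u hu]
        have hne : u ≠ w := fun h' => hw (h' ▸ hu)
        congr 1
        ext e
        simp only [Finset.mem_filter, Finset.mem_univ, true_and]
        by_cases he : e ∈ S <;> simp [he, hne]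

/-! ### Transport and prescribed colour counts -/

theorem exists_equiv_of_card_fibers_eq {E E' X : Type*} [Fintype E] [Fintype E'] [DecidableEq X]
    (f : E → X) (g : E' → X) (h : ∀ x, (Finset.univ.filter fun e => f e = x).card =
      (Finset.univ.filter fun e => g e = x).card) : ∃ σ : E ≃ E', ∀ e, g (σ e) = f e := by
  have hx : ∀ x, Nonempty ({e // f e = x} ≃ {e // g e = x}) := fun x =>
    Fintype.card_eq.1 (by simpa [Fintype.card_subtype] using h x)
  have ε := fun x => (hx x).some
  refine ⟨(Equiv.sigmaFiberEquiv f).symm.trans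
    ((Equiv.sigmaCongrRight ε).trans (Equiv.sigmaFiberEquiv g)), fun e => ?_⟩
  exact (ε (f e) ⟨e, rfl⟩).2

/-- Cut each size class into blocks of sizes `A i j` by a bijection with their disjoint union, and
read the colour off the block. -/
theorem exists_coloring_of_counts {E M C : Type*} [Fintype E] [Fintype M] [Fintype C]
    [DecidableEq M] [DecidableEq C] (sz : E → M) (A : C → M → ℕ)
    (hA : ∀ j, ∑ i, A i j = (Finset.univ.filter fun e => sz e = j).card) :
    ∃ c : E → C, ∀ i j, (Finset.univ.filter fun e => c e = i ∧ sz e = j).card = A i j := by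
  obtain ⟨σ, hσ⟩ := exists_equiv_of_card_fibers_eq sz
    (fun y : Σ x : C × M, Fin (A x.1 x.2) => y.1.2) (fun j => by
      rw [← hA, Finset.card_filter, Fintype.sum_sigma, Fintype.sum_prod_type]
      simp [apply_ite])
  refine ⟨fun e => (σ e).1.1, fun i j => ?_⟩
  have h1 : (Finset.univ.filter fun e => (σ e).1.1 = i ∧ sz e = j).card =
      (Finset.univ.filter fun y : Σ x : C × M, Fin (A x.1 x.2) => y.1 = (i, j)).card := by
    refine Finset.card_equiv σ fun e => ?_
    simp [Prod.ext_iff, hσ]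
  rw [h1, Finset.card_filter, Fintype.sum_sigma]
  simp [apply_ite]

/-! ### Counting partial transversals -/

section Counting

variable {V ι : Type*} [Fintype V] [DecidableEq ι]

/-- The sets of vertices that meet each part in `T` exactly once, and no other part. -/
def transversals (part : V → ι) (T : Finset ι) : Finset (Finset V) :=
  Finset.univ.filter fun U => U.image part = T ∧ U.card = T.card

theorem mem_transversals {part : V → ι} {T : Finset ι} {U : Finset V} :
    U ∈ transversals part T ↔ U.image part = T ∧ U.card = T.card := by
  simp [transversals]

theorem injOn_of_mem_transversals {part : V → ι} {T : Finset ι} {U : Finset V}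
    (h : U ∈ transversals part T) : Set.InjOn part U := by
  rw [mem_transversals] at h
  rw [← Finset.card_image_iff, h.1, h.2]

theorem card_filter_partial_transversals [Fintype ι] (part : V → ι) (s : ℕ) (P : Finset V → Prop)
    [DecidablePred P] :
    (Finset.univ.filter fun U : Finset V => U.card = s ∧ (U.image part).card = U.card ∧ P U).card =
      ∑ T ∈ Finset.powersetCard s Finset.univ, ((transversals part T).filter P).card := by
  rw [Finset.card_eq_sum_card_fiberwise (f := fun U => U.image part)
    (t := Finset.powersetCard s Finset.univ)]
  · refine Finset.sum_congr rfl fun T hT => ?_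
    rw [Finset.mem_powersetCard] at hT
    congr 1
    ext U
    simp only [Finset.mem_filter, Finset.mem_univ, true_and, mem_transversals]
    constructor
    · rintro ⟨⟨h1, h2, h3⟩, rfl⟩
      exact ⟨⟨rfl, h2.symm⟩, h3⟩
    · rintro ⟨⟨rfl, h2⟩, h3⟩
      exact ⟨⟨h2.trans hT.2, h2.symm, h3⟩, rfl⟩
  · intro U hU
    have hU : U.card = s ∧ (U.image part).card = U.card ∧ P U := by simpa using hU
    simp [Finset.mem_powersetCard, hU.2.1, hU.1]

variable [DecidableEq V]

theorem card_transversals_insert_mem (part : V → ι) {v : V} {T : Finset ι} (hv : part v ∉ T) :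
    ((transversals part (insert (part v) T)).filter fun U => v ∈ U).card =
      (transversals part T).card := by
  refine Finset.card_bij' (fun U _ => U.erase v) (fun U _ => insert v U) ?_ ?_ ?_ ?_
  · intro U hU
    rw [Finset.mem_filter, mem_transversals, Finset.card_insert_of_notMem hv] at hU
    obtain ⟨⟨h1, h2⟩, h3⟩ := hU
    have h4 := Finset.card_erase_add_one h3
    rw [mem_transversals]
    refine ⟨?_, by omega⟩
    rw [← Finset.insert_erase h3, Finset.image_insert] at h1
    have h5 : part v ∉ (U.erase v).image part := by
      intro h6
      rw [Finset.insert_eq_of_mem h6] at h1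
      have h7 := Finset.card_image_le (s := U.erase v) (f := part)
      rw [h1, Finset.card_insert_of_notMem hv] at h7
      omega
    rw [← Finset.erase_insert h5, h1, Finset.erase_insert hv]
  · intro U hU
    rw [mem_transversals] at hU
    have hvU : v ∉ U := fun h => hv (hU.1 ▸ Finset.mem_image_of_mem part h)
    rw [Finset.mem_filter, mem_transversals, Finset.image_insert, hU.1,
      Finset.card_insert_of_notMem hvU, Finset.card_insert_of_notMem hv, hU.2]
    exact ⟨⟨rfl, rfl⟩, Finset.mem_insert_self _ _⟩
  · intro U hU
    exact Finset.insert_erase (Finset.mem_filter.1 hU).2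
  · intro U hU
    rw [mem_transversals] at hU
    exact Finset.erase_insert fun h => hv (hU.1 ▸ Finset.mem_image_of_mem part h)

/-- When a part is added, each new transversal is counted once, at its unique vertex in that part.
-/
theorem card_transversals (part : V → ι) (T : Finset ι) :
    (transversals part T).card = ∏ w ∈ T, (Finset.univ.filter fun v => part v = w).card := by
  induction T using Finset.induction_on with
  | empty =>
    have : transversals part ∅ = {∅} := by
      ext U
      rw [mem_transversals]
      simp
    simp [this]
  | insert w T hw ih =>
    rw [Finset.prod_insert hw, ← ih, ← smul_eq_mul, ← Finset.sum_const]
    have h1 : ∀ v ∈ Finset.univ.filter fun v => part v = w, (transversals part T).card =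
        ∑ U ∈ transversals part (insert w T), if v ∈ U then 1 else 0 := by
      intro v hv
      obtain rfl : part v = w := by simpa using hv
      rw [← card_transversals_insert_mem part hw, Finset.card_filter]
    rw [Finset.sum_congr rfl h1, Finset.sum_comm, Finset.card_eq_sum_ones]
    refine Finset.sum_congr rfl fun U hU => ?_
    have hinj := injOn_of_mem_transversals hU
    rw [mem_transversals] at hU
    obtain ⟨u, hu, huw⟩ : ∃ u ∈ U, part u = w := by
      rw [← Finset.mem_image, hU.1]
      exact Finset.mem_insert_self _ _
    rw [Finset.sum_eq_single u]
    · simp [hu]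
    · intro v hv hne
      rw [if_neg]
      exact fun hvU => hne (hinj hvU hu (by rw [huw]; simpa using hv))
    · simp [huw]

/-- Injectivity of `h` lets the vertex set determine the size index. The predicate `P` serves both
for counting all edges of a size and for counting those through a vertex. -/
theorem card_filter_supp {E M : Type*} [Fintype E] [DecidableEq M] {part : V → ι}
    {lam h : M → ℕ} (hinj : Function.Injective h) {sz : E → M} {supp : E → Finset V}
    (hcard : ∀ e, (supp e).card = h (sz e))
    (htr : ∀ e, ((supp e).image part).card = (supp e).card)
    (hmult : ∀ j U, U.card = h j → (U.image part).card = U.card →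
      (Finset.univ.filter fun e => supp e = U).card = lam j)
    (j : M) (P : Finset V → Prop) [DecidablePred P] :
    (Finset.univ.filter fun e => sz e = j ∧ P (supp e)).card = lam j *
      (Finset.univ.filter fun U : Finset V =>
        U.card = h j ∧ (U.image part).card = U.card ∧ P U).card := by
  rw [Finset.card_eq_sum_card_fiberwise (f := supp) (t := Finset.univ.filter fun U : Finset V =>
    U.card = h j ∧ (U.image part).card = U.card ∧ P U), mul_comm, ← smul_eq_mul, ← Finset.sum_const]
  · refine Finset.sum_congr rfl fun U hU => ?_
    have hU : U.card = h j ∧ (U.image part).card = U.card ∧ P U := by simpa using hU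
    rw [← hmult j U hU.1 hU.2.1]
    congr 1
    ext e
    simp only [Finset.mem_filter, Finset.mem_univ, true_and]
    constructor
    · exact fun he => he.2
    · rintro rfl
      exact ⟨⟨hinj (by rw [← hcard, hU.1]), hU.2.2⟩, rfl⟩
  · intro e he
    have he : sz e = j ∧ P (supp e) := by simpa using he
    simp [hcard, htr, he.1, he.2]

variable [Fintype ι]

theorem card_partial_transversals (part : V → ι) (s : ℕ) :
    (Finset.univ.filter fun U : Finset V => U.card = s ∧ (U.image part).card = U.card).card =
      ∑ T ∈ Finset.powersetCard s Finset.univ,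
        ∏ w ∈ T, (Finset.univ.filter fun v => part v = w).card := by
  simpa [card_transversals] using card_filter_partial_transversals part s fun _ => True

/-- Fixing `v` excludes its own part and leaves an elementary symmetric function of the other part
sizes; this gives vertex degrees. -/
theorem card_partial_transversals_mem (part : V → ι) (s : ℕ) (v : V) :
    (Finset.univ.filter fun U : Finset V =>
      U.card = s + 1 ∧ (U.image part).card = U.card ∧ v ∈ U).card =
      ∑ T ∈ Finset.powersetCard s (Finset.univ.erase (part v)),
        ∏ w ∈ T, (Finset.univ.filter fun v => part v = w).card := by
  have hni : part v ∉ (Finset.univ.erase (part v) : Finset ι) := Finset.notMem_erase _ _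
  rw [card_filter_partial_transversals, ← Finset.insert_erase (Finset.mem_univ (part v)),
    Finset.powersetCard_succ_insert hni, Finset.sum_union, Finset.sum_image, Finset.sum_eq_zero,
    zero_add, Finset.erase_insert hni]
  · refine Finset.sum_congr rfl fun T hT => ?_
    rw [card_transversals_insert_mem, card_transversals]
    exact fun h => hni ((Finset.mem_powersetCard.1 hT).1 h)
  · intro T hT
    rw [Finset.card_eq_zero, Finset.filter_eq_empty_iff]
    intro U hU hv
    rw [mem_transversals] at hU
    exact hni ((Finset.mem_powersetCard.1 hT).1 (hU.1 ▸ Finset.mem_image_of_mem part hv))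
  · intro T hT T' hT' h
    have h1 : part v ∉ T := fun h => hni ((Finset.mem_powersetCard.1 hT).1 h)
    have h2 : part v ∉ T' := fun h => hni ((Finset.mem_powersetCard.1 hT').1 h)
    rw [← Finset.erase_insert h1, h, Finset.erase_insert h2]
  · rw [Finset.disjoint_left]
    intro T hT hT'
    obtain ⟨T', -, rfl⟩ := Finset.mem_image.1 hT'
    exact hni ((Finset.mem_powersetCard.1 hT).1 (Finset.mem_insert_self _ _))

end Counting

/-! ### The two implications for families of partial transversals -/

/-- Sufficiency of the numerical conditions, for a family `supp` of partial transversals of a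
partition into parts of equal size. -/
theorem exists_coloring_of_numerical_conditions {E V ι M C : Type*} [Fintype E] [DecidableEq E]
    [Fintype V] [DecidableEq V] [Fintype ι] [DecidableEq ι] [Fintype M] [DecidableEq M]
    [Fintype C] [DecidableEq C] {part : V → ι} {lam h : M → ℕ} (hinj : Function.Injective h)
    {sz : E → M} {supp : E → Finset V} (hcard : ∀ e, (supp e).card = h (sz e))
    (htr : ∀ e, ((supp e).image part).card = (supp e).card)
    (hmult : ∀ j U, U.card = h j → (U.image part).card = U.card →
      (Finset.univ.filter fun e => supp e = U).card = lam j)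
    {q : ℕ} (hq : 0 < q) (hpart : ∀ w, (Finset.univ.filter fun v => part v = w).card = q)
    (r : C → ℕ) (A : C → M → ℕ) (hAr : ∀ i, ∑ j, A i j * h j = Fintype.card ι * q * r i)
    (hAl : ∀ j, ∑ i, A i j = lam j * (Fintype.card ι).choose (h j) * q ^ h j) :
    ∃ c : E → C, ∀ i v, (Finset.univ.filter fun e => c e = i ∧ v ∈ supp e).card = r i := by
  have hsz : ∀ j, (Finset.univ.filter fun e => sz e = j).card =
      lam j * (Fintype.card ι).choose (h j) * q ^ h j := by
    intro j
    have h1 := card_filter_supp hinj hcard htr hmult j fun _ => True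
    simp only [and_true] at h1
    rw [h1, card_partial_transversals]
    simp only [hpart, Finset.prod_const]
    rw [Finset.sum_congr rfl fun T hT => by rw [(Finset.mem_powersetCard.1 hT).2],
      Finset.sum_const, Finset.card_powersetCard, Finset.card_univ, smul_eq_mul, mul_assoc]
  obtain ⟨c, hc⟩ := exists_coloring_of_counts sz A fun j => (hAl j).trans (hsz j).symm
  obtain ⟨τ, τcard, τmult, τdeg⟩ := exists_balanced_subsets (ι := ι) sz c h
    (fun j => lam j * q ^ h j) (fun i => q * r i) (fun j => by rw [hsz]; ring) (fun i => by
      rw [← mul_assoc, ← hAr, ← Finset.sum_fiberwise_of_maps_to (g := sz) (t := Finset.univ)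
        (fun _ _ => Finset.mem_univ _)]
      refine Finset.sum_congr rfl fun j _ => ?_
      rw [Finset.filter_filter, ← hc, ← smul_eq_mul, ← Finset.sum_const]
      refine Finset.sum_congr rfl fun e he => ?_
      rw [(Finset.mem_filter.1 he).2.2])
  -- As `h` is injective, the sum has at most one nonzero term: the multiplicity for the size of
  -- `T`.
  have τL : ∀ T, (Finset.univ.filter fun e => τ e = T).card =
      (∑ j, if h j = T.card then lam j else 0) * q ^ T.card := by
    intro T
    by_cases hT : ∃ j, h j = T.card
    · obtain ⟨j, hj⟩ := hT
      rw [Finset.sum_eq_single j, if_pos hj, ← hj, ← τmult j T hj.symm]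
      · congr 1
        ext e
        simp only [Finset.mem_filter, Finset.mem_univ, true_and, iff_and_self]
        rintro rfl
        exact hinj ((τcard e).symm.trans hj.symm)
      · exact fun j' _ hne => if_neg fun h' => hne (hinj (h'.trans hj.symm))
      · simp
    · rw [Finset.sum_eq_zero fun j _ => if_neg fun h' => hT ⟨j, h'⟩, zero_mul, Finset.card_eq_zero,
        Finset.filter_eq_empty_iff]
      rintro e - rfl
      exact hT ⟨sz e, (τcard e).symm⟩
  obtain ⟨f, fdeg, fmult⟩ := exists_balanced_transversals hq τ c r _ τdeg τL
  obtain ⟨idx, idx_inj, idx_surj⟩ : ∃ idx : V → Fin q,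
      (∀ u v, part u = part v → idx u = idx v → u = v) ∧ ∀ w x, ∃ v, part v = w ∧ idx v = x := by
    have hε : ∀ w, Nonempty ({v // part v = w} ≃ Fin q) := fun w =>
      Fintype.card_eq.1 (by rw [Fintype.card_subtype, hpart, Fintype.card_fin])
    have ε := fun w => (hε w).some
    have hε : ∀ w (v : {v // part v = w}), ε (part v) ⟨v, rfl⟩ = ε w v := by
      rintro _ ⟨v, rfl⟩
      rfl
    refine ⟨fun v => ε (part v) ⟨v, rfl⟩, fun u v huv h' => ?_, fun w x => ?_⟩
    · have h1 := hε (part v) ⟨u, huv⟩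
      have h2 := (ε (part v)).injective (h1.symm.trans h')
      exact congrArg Subtype.val h2
    · exact ⟨(ε w).symm x, ((ε w).symm x).2, by simp [hε]⟩
  let φ : E → Finset V := fun e =>
    Finset.univ.filter fun v => part v ∈ τ e ∧ f e (part v) = idx v
  have mem_φ : ∀ e v, v ∈ φ e ↔ part v ∈ τ e ∧ f e (part v) = idx v := fun e v => by simp [φ]
  have φ_image : ∀ e, (φ e).image part = τ e := by
    intro e
    ext w
    rw [Finset.mem_image]
    constructor
    · rintro ⟨v, hv, rfl⟩
      exact ((mem_φ e v).1 hv).1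
    · intro hw
      obtain ⟨v, rfl, hv⟩ := idx_surj w (f e w)
      exact ⟨v, (mem_φ e v).2 ⟨hw, hv.symm⟩, rfl⟩
  have φ_card : ∀ e, ((φ e).image part).card = (φ e).card := by
    intro e
    refine Finset.card_image_of_injOn fun u hu v hv huv => idx_inj u v huv ?_
    rw [← ((mem_φ e u).1 hu).2, ← ((mem_φ e v).1 hv).2, huv]
  -- Both families use a partial transversal of size `h j` exactly `lam j` times, and no other set.
  have fib : ∀ U, (Finset.univ.filter fun e => φ e = U).card =
      (Finset.univ.filter fun e => supp e = U).card := by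
    intro U
    by_cases hU : (U.image part).card = U.card ∧ ∃ j, h j = U.card
    · obtain ⟨hU, j, hj⟩ := hU
      have hUinj := Finset.card_image_iff.1 hU
      obtain ⟨g, hg⟩ : ∃ g : ι → Fin q, ∀ u ∈ U, g (part u) = idx u := by
        refine ⟨fun w => if hw : ∃ u ∈ U, part u = w then idx hw.choose else ⟨0, hq⟩,
          fun u hu => ?_⟩
        have hw : ∃ u' ∈ U, part u' = part u := ⟨u, hu, rfl⟩
        refine (dif_pos hw).trans ?_
        rw [hUinj hw.choose_spec.1 hu hw.choose_spec.2]
      rw [hmult j U hj.symm hU]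
      have h1 := fmult (U.image part) g
      rw [hU, Finset.sum_eq_single j, if_pos hj] at h1
      · rw [← h1]
        congr 1
        ext e
        simp only [Finset.mem_filter, Finset.mem_univ, true_and]
        constructor
        · rintro rfl
          refine ⟨(φ_image e).symm, fun w hw => ?_⟩
          obtain ⟨u, hu, rfl⟩ := Finset.mem_image.1 hw
          rw [hg u hu, ((mem_φ e u).1 hu).2]
        · rintro ⟨h2, h3⟩
          ext v
          rw [mem_φ, h2]
          constructor
          · rintro ⟨hv, hfv⟩
            obtain ⟨u, hu, huv⟩ := Finset.mem_image.1 hv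
            rw [h3 _ hv, ← huv, hg u hu] at hfv
            exact idx_inj u v huv hfv ▸ hu
          · intro hv
            have hv' := Finset.mem_image_of_mem part hv
            exact ⟨hv', (h3 _ hv').trans (hg v hv)⟩
      · exact fun j' _ hne => if_neg fun h' => hne (hinj (h'.trans hj.symm))
      · simp
    · rw [Finset.filter_false_of_mem, Finset.filter_false_of_mem]
      · rintro e - rfl
        exact hU ⟨htr e, sz e, (hcard e).symm⟩
      · rintro e - rfl
        exact hU ⟨φ_card e, sz e, by rw [← φ_card, φ_image, τcard]⟩
  obtain ⟨σ, hσ⟩ := exists_equiv_of_card_fibers_eq φ supp fib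
  refine ⟨fun e => c (σ.symm e), fun i v => ?_⟩
  rw [← fdeg i (part v) (idx v)]
  refine (Finset.card_equiv σ fun e => ?_).symm
  simp [hσ, mem_φ]

/-- Necessity of the numerical conditions, for a family `supp` of partial transversals of a
partition into nonempty parts. -/
theorem numerical_conditions_of_exists_coloring {E V ι M C : Type*} [Fintype E]
    [Fintype V] [DecidableEq V] [Fintype ι] [DecidableEq ι] [Nonempty ι] [Fintype M]
    [DecidableEq M] [Nonempty M] [Fintype C] [DecidableEq C] {part : V → ι} {lam h : M → ℕ}
    (hinj : Function.Injective h) (hlam : ∀ j, 0 < lam j)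
    (hh : ∀ j, 2 ≤ h j ∧ h j ≤ Fintype.card ι)
    {sz : E → M} {supp : E → Finset V} (hcard : ∀ e, (supp e).card = h (sz e))
    (htr : ∀ e, ((supp e).image part).card = (supp e).card)
    (hmult : ∀ j U, U.card = h j → (U.image part).card = U.card →
      (Finset.univ.filter fun e => supp e = U).card = lam j)
    (hpart : ∀ w, 0 < (Finset.univ.filter fun v => part v = w).card)
    (r : C → ℕ) (c : E → C)
    (hc : ∀ i v, (Finset.univ.filter fun e => c e = i ∧ v ∈ supp e).card = r i) :
    ∃ q : ℕ, (∀ w, (Finset.univ.filter fun v => part v = w).card = q) ∧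
      ∑ i, r i = ∑ j, lam j * (Fintype.card ι - 1).choose (h j - 1) * q ^ (h j - 1) ∧
      ∃ A : C → M → ℕ, (∀ i, ∑ j, A i j * h j = Fintype.card ι * q * r i) ∧
        ∀ j, ∑ i, A i j = lam j * (Fintype.card ι).choose (h j) * q ^ h j := by
  set p : ι → ℕ := fun w => (Finset.univ.filter fun v => part v = w).card with hp
  have hdeg : ∀ w, ∑ i, r i = ∑ j, lam j *
      ∑ T ∈ Finset.powersetCard (h j - 1) (Finset.univ.erase w), ∏ u ∈ T, p u := by
    intro w
    obtain ⟨v, hv⟩ := Finset.card_pos.1 (hpart w)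
    obtain rfl : part v = w := by simpa using hv
    have h1 : ∑ i, r i = (Finset.univ.filter fun e => v ∈ supp e).card := by
      rw [Finset.card_eq_sum_card_fiberwise (f := c) (t := Finset.univ) (by simp)]
      refine Finset.sum_congr rfl fun i _ => ?_
      rw [← hc i v, Finset.filter_filter]
      simp only [and_comm]
    rw [h1, Finset.card_eq_sum_card_fiberwise (f := sz) (t := Finset.univ) (by simp)]
    refine Finset.sum_congr rfl fun j _ => ?_
    rw [← card_partial_transversals_mem, Nat.sub_add_cancel (by linarith [(hh j).1]),
      ← card_filter_supp hinj hcard htr hmult j fun U => v ∈ U, Finset.filter_filter]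
    simp only [and_comm]
  have hall : ∀ w w', p w = p w' := by
    intro w w'
    by_cases hne : w = w'
    · rw [hne]
    -- `rest` is symmetric in `w` and `w'`. Sorting the sets of parts that avoid one of them by
    -- whether they contain the other isolates a linear dependence on a single part size.
    let rest : Finset ι := (Finset.univ.erase w).erase w'
    let a : ℕ → ℕ := fun s => ∑ T ∈ Finset.powersetCard s rest, ∏ u ∈ T, p u
    have split : ∀ x x', x ≠ x' → (Finset.univ.erase x).erase x' = rest →
        ∑ i, r i = ∑ j, lam j * a (h j - 1) + p x' * ∑ j, lam j * a (h j - 2) := by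
      intro x x' hx hr
      have h1 : (Finset.univ.erase x : Finset ι) = insert x' rest := by
        rw [← hr, Finset.insert_erase (by simp [Ne.symm hx])]
      have hx' : x' ∉ rest := by rw [← hr]; exact Finset.notMem_erase _ _
      rw [hdeg x, Finset.mul_sum, ← Finset.sum_add_distrib]
      refine Finset.sum_congr rfl fun j _ => ?_
      obtain ⟨b, hb⟩ : ∃ b, h j = b + 2 := ⟨h j - 2, by have := (hh j).1; omega⟩
      rw [h1, hb, show b + 2 - 1 = b + 1 by omega, show b + 2 - 2 = b by omega,
        Finset.powersetCard_succ_insert hx', Finset.sum_union, Finset.sum_image]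
      · have h2 : ∀ T ∈ Finset.powersetCard b rest, ∏ u ∈ insert x' T, p u =
            p x' * ∏ u ∈ T, p u := fun T hT =>
          Finset.prod_insert fun h' => hx' ((Finset.mem_powersetCard.1 hT).1 h')
        rw [Finset.sum_congr rfl h2, ← Finset.mul_sum]
        ring
      · intro T hT T' hT' h'
        have h1 : x' ∉ T := fun h' => hx' ((Finset.mem_powersetCard.1 hT).1 h')
        have h2 : x' ∉ T' := fun h' => hx' ((Finset.mem_powersetCard.1 hT').1 h')
        rw [← Finset.erase_insert h1, h', Finset.erase_insert h2]
      · rw [Finset.disjoint_left]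
        intro T hT hT'
        obtain ⟨T', -, rfl⟩ := Finset.mem_image.1 hT'
        exact hx' ((Finset.mem_powersetCard.1 hT).1 (Finset.mem_insert_self _ _))
    have h1 := split w w' hne rfl
    have h2 := split w' w (Ne.symm hne) Finset.erase_right_comm
    -- The common coefficient of the two part sizes is positive since `h j - 2` is at most the
    -- number of parts in `rest`; it can be cancelled.
    have hpos : 0 < ∑ j, lam j * a (h j - 2) := by
      refine Finset.sum_pos (fun j _ => Nat.mul_pos (hlam j) ?_) Finset.univ_nonempty
      refine Finset.sum_pos (fun T _ => Finset.prod_pos fun u _ => hpart u) ?_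
      rw [Finset.powersetCard_nonempty, Finset.card_erase_of_mem (by simp [Ne.symm hne]),
        Finset.card_erase_of_mem (Finset.mem_univ _), Finset.card_univ]
      have := (hh j).2
      omega
    exact Nat.eq_of_mul_eq_mul_right hpos (by omega)
  obtain ⟨w₀⟩ := ‹Nonempty ι›
  have hq : ∀ w, p w = p w₀ := fun w => hall w w₀
  have sumT : ∀ s (S : Finset ι), ∑ T ∈ Finset.powersetCard s S, ∏ u ∈ T, p u =
      S.card.choose s * p w₀ ^ s := by
    intro s S
    simp only [hq, Finset.prod_const]
    rw [Finset.sum_congr rfl fun T hT => by rw [(Finset.mem_powersetCard.1 hT).2],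
      Finset.sum_const, Finset.card_powersetCard, smul_eq_mul]
  refine ⟨p w₀, hq, ?_, fun i j => (Finset.univ.filter fun e => c e = i ∧ sz e = j).card,
    fun i => ?_, fun j => ?_⟩
  · rw [hdeg w₀]
    refine Finset.sum_congr rfl fun j _ => ?_
    rw [sumT, Finset.card_erase_of_mem (Finset.mem_univ _), Finset.card_univ, mul_assoc]
  · have hV : Fintype.card ι * p w₀ = Fintype.card V := by
      rw [← Finset.card_univ (α := V),
        Finset.card_eq_sum_card_fiberwise (f := part) (t := Finset.univ) (by simp),
        Finset.sum_congr rfl fun w _ => hq w, Finset.sum_const, Finset.card_univ, smul_eq_mul]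
    rw [hV]
    calc ∑ j, (Finset.univ.filter fun e => c e = i ∧ sz e = j).card * h j
        = ∑ e with c e = i, (supp e).card := by
          rw [← Finset.sum_fiberwise_of_maps_to (g := sz) (t := Finset.univ)
            (fun _ _ => Finset.mem_univ _)]
          refine Finset.sum_congr rfl fun j _ => ?_
          rw [Finset.filter_filter, ← smul_eq_mul, ← Finset.sum_const]
          refine Finset.sum_congr rfl fun e he => ?_
          rw [hcard, (Finset.mem_filter.1 he).2.2]
      _ = ∑ e with c e = i, ∑ v, if v ∈ supp e then 1 else 0 := by simp
      _ = ∑ v, (Finset.univ.filter fun e => c e = i ∧ v ∈ supp e).card := by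
          rw [Finset.sum_comm]
          refine Finset.sum_congr rfl fun v _ => ?_
          rw [Finset.sum_boole, Finset.filter_filter, Nat.cast_id]
      _ = Fintype.card V * r i := by simp [hc]
  · have h1 := card_filter_supp hinj hcard htr hmult j fun _ => True
    simp only [and_true] at h1
    rw [mul_assoc, ← Finset.card_univ (α := ι), ← sumT, ← card_partial_transversals, ← h1,
      Finset.card_eq_sum_card_fiberwise (f := c) (t := Finset.univ) (by simp)]
    refine Finset.sum_congr rfl fun i _ => ?_
    rw [Finset.filter_filter]
    simp only [and_comm]

/-! ### Factorizations as edge colourings -/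

namespace HingeHypergraph

open Classical in
theorem hingeCount_eq_ite {V E X : Type*} (G : HingeHypergraph V E X) {e : E}
    {U : Finset V} (he : e ∈ G.edgesOn U.val) (v : V) :
    G.hingeCount v e = if v ∈ U then 1 else 0 := by
  rw [he v]
  split_ifs with hv
  · exact Multiset.count_eq_one_of_mem U.nodup hv
  · exact Multiset.count_eq_zero_of_notMem hv

theorem eq_of_mem_edgesOn {V E X : Type*} (G : HingeHypergraph V E X) {e : E} {U U' : Finset V}
    (h : e ∈ G.edgesOn U.val) (h' : e ∈ G.edgesOn U'.val) : U = U' := by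
  classical
  ext v
  have := (G.hingeCount_eq_ite h v).symm.trans (G.hingeCount_eq_ite h' v)
  by_cases hv : v ∈ U <;> by_cases hv' : v ∈ U' <;> simp_all

/-- Hinge counts are 0 or 1, so the hinges at `v` correspond bijectively to the edges through `v`.
-/
theorem degree_spanningSub {V E X : Type*} (G : HingeHypergraph V E X) {supp : E → Finset V}
    (hs : ∀ e, e ∈ G.edgesOn (supp e).val) (S : Set E) (v : V) :
    (G.spanningSub S).degree v = Set.ncard {e | e ∈ S ∧ v ∈ supp e} := by
  classical
  have hfin := G.finite_hinges
  refine Set.ncard_congr (fun x _ => G.edge x.1) ?_ ?_ ?_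
  · rintro ⟨x, hx⟩ (hv : G.vert x = v)
    refine ⟨hx, by_contra fun h => ?_⟩
    have h1 := G.hingeCount_eq_ite (hs (G.edge x)) v
    rw [if_neg h, hingeCount, Set.ncard_eq_zero (Set.toFinite _)] at h1
    exact Set.eq_empty_iff_forall_notMem.1 h1 x ⟨hv, rfl⟩
  · rintro ⟨x, hx⟩ ⟨y, hy⟩ (hv : G.vert x = v) (hv' : G.vert y = v) (hxy : G.edge x = G.edge y)
    have h1 := G.hingeCount_eq_ite (hs (G.edge x)) v
    have h2 : G.hingeCount v (G.edge x) ≤ 1 := by rw [h1]; split_ifs <;> omega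
    exact Subtype.ext ((Set.ncard_le_one (Set.toFinite _)).1 h2 x ⟨hv, rfl⟩ y ⟨hv', hxy.symm⟩)
  · rintro e ⟨he, hv⟩
    have h1 := G.hingeCount_eq_ite (hs e) v
    rw [if_pos hv] at h1
    obtain ⟨x, hx, rfl⟩ := Set.nonempty_of_ncard_ne_zero (by rw [← hingeCount, h1]; exact one_ne_zero)
    exact ⟨⟨x, he⟩, hx, rfl⟩

/-- A factorization of a hypergraph without repeated hinges is a colouring of the edges in which
every vertex `v` is on exactly `R i` edges of colour `i`. -/
theorem isFactorizable_iff_exists_coloring {V E X : Type*} [Fintype E] [DecidableEq V] [Nonempty V]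
    (G : HingeHypergraph V E X) {supp : E → Finset V} (hs : ∀ e, e ∈ G.edgesOn (supp e).val)
    {k : ℕ} (R : Fin k → ℕ) (hR : ∀ i, 0 < R i) :
    G.IsFactorizable R ↔ ∃ c : E → Fin k, ∀ i v,
      (Finset.univ.filter fun e => c e = i ∧ v ∈ supp e).card = R i := by
  constructor
  · rintro ⟨F, -, hdisj, hunion, hreg⟩
    have hex : ∀ e, ∃ i, e ∈ F i := fun e => Set.mem_iUnion.1 (hunion ▸ Set.mem_univ e)
    choose c hc using hex
    refine ⟨c, fun i v => ?_⟩
    rw [← hreg i v, G.degree_spanningSub hs, ← Set.ncard_coe_finset]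
    congr 1
    ext e
    have : c e = i ↔ e ∈ F i := by
      refine ⟨fun h => h ▸ hc e, fun h => by_contra fun hne => ?_⟩
      exact Set.disjoint_left.1 (hdisj hne) (hc e) h
    simp [this]
  · rintro ⟨c, hc⟩
    refine ⟨fun i => {e | c e = i}, fun i => ?_, fun i j hij => ?_, ?_, fun i v => ?_⟩
    -- Nonempty factors come from `0 < R i` at any one vertex.
    · obtain ⟨v⟩ := ‹Nonempty V›
      obtain ⟨e, he⟩ := Finset.card_pos.1 ((hR i).trans_eq (hc i v).symm)
      exact ⟨e, (Finset.mem_filter.1 he).2.1⟩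
    · refine Set.disjoint_left.2 ?_
      rintro e rfl h
      exact hij h
    · ext e
      simp
    · rw [G.degree_spanningSub hs, ← hc i v, ← Set.ncard_coe_finset]
      congr 1
      ext e
      simp

end HingeHypergraph

/-! ### The characterization -/

theorem theorem6p2 {V E X : Type*} (G : HingeHypergraph V E X)
    {k m n : ℕ} (hk : 0 < k) (hm : 0 < m)
    (R : Fin k → ℕ) (hR : ∀ i, 0 < R i)
    (lam : Fin m → ℕ) (hlam : ∀ j, 0 < lam j)
    (h : Fin m → ℕ) (hh : ∀ j, 2 ≤ h j ∧ h j ≤ n) (hinj : Function.Injective h)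
    (p : Fin n → ℕ) (hp : ∀ i, 0 < p i)
    (part : V → Fin n) (hG : G.IsLambdaK lam h p part) :
    G.IsFactorizable R ↔
      ∃ q : ℕ, (∀ i, p i = q) ∧
        ∑ i, R i = ∑ j, lam j * (n - 1).choose (h j - 1) * q ^ (h j - 1) ∧
        ∃ A : Matrix (Fin k) (Fin m) ℕ,
          A.mulVec h = (n * q) • R ∧
          ∀ j, ∑ i, A i j = lam j * n.choose (h j) * q ^ (h j) := by

  classical
  have := G.finite_vertices
  have := G.finite_edges
  cases nonempty_fintype V
  cases nonempty_fintype E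
  have : Nonempty (Fin m) := ⟨⟨0, hm⟩⟩
  have hn : 0 < n := by have := hh ⟨0, hm⟩; omega
  have : Nonempty (Fin n) := ⟨⟨0, hn⟩⟩
  have hpart : ∀ w, (Finset.univ.filter fun v => part v = w).card = p w := by
    intro w
    rw [← hG.card_part w, ← Set.ncard_coe_finset]
    congr 1
    ext v
    simp
  have : Nonempty V := by
    obtain ⟨v, -⟩ := Finset.card_pos.1 ((hp ⟨0, hn⟩).trans_eq (hpart ⟨0, hn⟩).symm)
    exact ⟨v⟩
  choose sz supp hcard htr hs using hG.edge_form
  have htr : ∀ e, ((supp e).image part).card = (supp e).card := fun e =>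
    Finset.card_image_iff.2 (htr e)
  have hmult : ∀ j U, U.card = h j → (U.image part).card = U.card →
      (Finset.univ.filter fun e => supp e = U).card = lam j := by
    intro j U hU hU'
    rw [← hG.mult_eq j U hU (Finset.card_image_iff.1 hU'), HingeHypergraph.mult,
      ← Set.ncard_coe_finset]
    congr 1
    ext e
    simp only [Finset.coe_filter, Finset.mem_univ, true_and, Set.mem_ofPred_eq]
    exact ⟨fun he => he ▸ hs e, G.eq_of_mem_edgesOn (hs e)⟩
  rw [G.isFactorizable_iff_exists_coloring hs R hR]
  have hmul : ∀ (q : ℕ) (A : Matrix (Fin k) (Fin m) ℕ), A.mulVec h = (n * q) • R ↔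
      ∀ i, ∑ j, A i j * h j = Fintype.card (Fin n) * q * R i := by
    intro q A
    rw [funext_iff, Fintype.card_fin]
    exact Iff.rfl
  constructor
  · rintro ⟨c, hc⟩
    obtain ⟨q, hq, hsum, A, hA, hA'⟩ := numerical_conditions_of_exists_coloring hinj hlam
      (by simpa using hh) hcard htr hmult (fun w => (hpart w).symm ▸ hp w) R c hc
    rw [Fintype.card_fin] at hsum hA'
    exact ⟨q, fun i => (hpart i).symm.trans (hq i), hsum, A, (hmul q A).2 hA, hA'⟩
  · rintro ⟨q, hq, -, A, hA, hA'⟩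
    exact exists_coloring_of_numerical_conditions hinj hcard htr hmult (hq ⟨0, hn⟩ ▸ hp _)
      (fun w => (hpart w).trans (hq w)) R A ((hmul q A).1 hA) (by simpa using hA')
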